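/- **Setting.** A resource allocation game has finitely many agents $1,\dots,n$, a finite set $\mathcal R$ of resources, and for each agent $i$ a nonempty set $\mathcal A_i\subseteq 2^{\mathcal R}$ of actions. For a profile $a=(a_1,\dots,a_n)$ let $|a|_r$ be the number of agents $i$ with $r\in a_i$. Every resource $r$ has a welfare rule $w_r:\mathbb N\to\mathbb R$ and a utility rule $f_r:\mathbb N\to\mathbb R_{\ge0}$; the system welfare is $W(a)=\sum_{r\in\bigcup_i a_i}w_r(|a|_r)$ and agent $i$ has utility $U_i(a)=\sum_{r\in a_i}f_r(|a|_r)$. In a one-round walk all agents start at the null action $\varnothing$, and agents $1,\dots,n$ move once each, in this order, each to an arbitrary best response in $\mathcal A_i$ to the current actions of the others; $\mathrm{sol}(1)$ is the set of all possible outcomes. The efficiency of a game $G$ is $\mathrm{Eff}(G;1)=\min_{a\in\mathrm{sol}(1)}W(a)\,/\max_{a\in\mathcal A_1\times\dots\times\mathcal A_n}W(a)$. For a set $\mathcal W$ of welfare rules and a utility design $\mathcal U:\mathcal W\to\mathbb R_{\ge0}^{\mathbb N}$, let $\mathrm{Eff}(\mathcal W,\mathcal U;1)$ be the infimum of $\mathrm{Eff}(G;1)$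 over all games (with positive maximal welfare) such that $w_r\in\mathcal W$ and $f_r=\mathcal U(w_r)$ for all $r$, and let $\mathrm{Eff}^*(\mathcal W;1)=\sup_{\mathcal U}\mathrm{Eff}(\mathcal W,\mathcal U;1)$. **Theorem.** Let $m\ge1$ and let $w^1,\dots,w^m$ be submodular welfare rules, i.e. $w^\ell(j+1)\ge w^\ell(j)$ and $w^\ell(j+1)-w^\ell(j)$ is nonincreasing in $j\ge0$, normalized by $w^\ell(0)=0$ and $w^\ell(1)=1$. Let $\mathcal W=\{\sum_\ell\alpha^\ell w^\ell:\alpha^1,\dots,\alpha^m\ge0\}$. For each $\ell$ consider the linear program: minimize $\beta$ over $\beta\ge0$ and $f\in\mathbb R_{\ge0}^{\mathbb N}$ with $f(1)=1$, subject to $$\beta\, w^\ell(y)\ \ge\ \sum_{i=1}^{y}f(i)-z\,f(y+1)+w^\ell(z)\qquad\text{for all integers } y\ge1,\ z\ge0 .$$ Its minimum $\beta^\ell$ is attained, is positive, and is attained by some $f$ that is nonincreasing on $\{1,2,\dots\}$. Moreover $$\mathrm{Eff}^*(\mathcal W;1)=\min_{1\le\ell\le m}\frac1{\beta^\ell}.$$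 Finally, let $u^\ell$, for each $\ell$, be any nonincreasing optimal solution of the $\ell$-th program. Then every utility design of the linear form $\mathcal U\big(\sum_\ell\alpha^\ell w^\ell\big)=\sum_\ell\alpha^\ell u^\ell$ (with one arbitrary representation $\sum_\ell\alpha^\ell w^\ell$, $\alpha^\ell\ge0$, chosen for each $w\in\mathcal W$ if the $w^\ell$ are linearly dependent) attains the optimum: $\mathrm{Eff}(\mathcal W,\mathcal U;1)=\mathrm{Eff}^*(\mathcal W;1)$. -/

import Mathlib

open scoped NNReal

namespace ResourceGame

/-- A welfare rule; `w j` is the welfare of a resource used by `j` agents. -/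
abbrev WelfareRule : Type := ℕ → ℝ

/-- A (nonnegative) utility rule; `f j` is what each of the `j` users of a resource gets. The value
`f 0` is never used. -/
abbrev UtilityRule : Type := ℕ → ℝ≥0

/-- The rule is nondecreasing and has nonincreasing marginal returns. -/
def IsSubmodular (w : WelfareRule) : Prop :=
  (∀ j, w j ≤ w (j + 1)) ∧ Antitone fun j => w (j + 1) - w j

/-- All nonnegative combinations of the basis rules. -/
def spanned {m : ℕ} (w : Fin m → WelfareRule) : Set WelfareRule :=
  {v | ∃ α : Fin m → ℝ≥0, v = ∑ l, (α l : ℝ) • w l}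

/-- A utility design assigns a utility rule to every welfare rule of the class. -/
abbrev UtilityDesign (𝒲 : Set WelfareRule) : Type := 𝒲 → UtilityRule

/-- A resource allocation game with agents `Fin n` and resources `Fin c`. -/
structure Game where
  /-- number of agents -/
  n : ℕ
  /-- number of resources -/
  c : ℕ
  /-- the action set of each agent: a nonempty finite set of sets of resources -/
  actions : Fin n → Finset (Finset (Fin c))
  actions_nonempty : ∀ i, (actions i).Nonempty
  /-- the welfare rule of each resource -/
  w : Fin c → WelfareRule
  /-- the utility rule of each resource -/
  f : Fin c → UtilityRule

namespace Game

/-- A choice of a set of resources for every agent (including the null profile, and not necessarily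
made of available actions). -/
abbrev Profile (G : Game) : Type := Fin G.n → Finset (Fin G.c)

/-- The joint actions of the game. -/
def jointActions (G : Game) : Set G.Profile := {a | ∀ i, a i ∈ G.actions i}

/-- The number of agents that use the resource `r`. -/
def load (G : Game) (a : G.Profile) (r : Fin G.c) : ℕ :=
  (Finset.univ.filter fun i => r ∈ a i).card

/-- The system welfare. -/
noncomputable def welfare (G : Game) (a : G.Profile) : ℝ :=
  ∑ r ∈ Finset.univ.biUnion a, G.w r (G.load a r)

/-- The utility of agent `i`. -/
noncomputable def utility (G : Game) (i : Fin G.n) (a : G.Profile) : ℝ :=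
  ∑ r ∈ a i, (G.f r (G.load a r) : ℝ)

/-- The best responses of agent `i` when the others play as in `a`. -/
def bestResponses (G : Game) (i : Fin G.n) (a : G.Profile) : Set (Finset (Fin G.c)) :=
  {b | b ∈ G.actions i ∧ ∀ b' ∈ G.actions i,
    G.utility i (Function.update a i b') ≤ G.utility i (Function.update a i b)}

/-- `a 0, a 1, …, a (k * n)` is a `k`-round walk: it starts at the null profile, and at time `τ` the
agent with index `τ mod n` (agents being numbered from `0`) moves to some best response. -/
def IsWalk (G : Game) (k : ℕ) (a : ℕ → G.Profile) : Prop :=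
  (a 0 = fun _ => ∅) ∧
    ∀ τ < k * G.n, ∀ i : Fin G.n, (i : ℕ) = τ % G.n →
      ∃ b ∈ G.bestResponses i (a τ), a (τ + 1) = Function.update (a τ) i b

/-- The possible outcomes of a `k`-round walk. -/
def sol (G : Game) (k : ℕ) : Set G.Profile := {s | ∃ a, G.IsWalk k a ∧ s = a (k * G.n)}

/-- The efficiency of the `k`-round walk: the worst welfare of an outcome over the best welfare
(extrema over finite nonempty sets when `1 ≤ k`). -/
noncomputable def efficiency (G : Game) (k : ℕ) : ℝ :=
  sInf (G.welfare '' G.sol k) / sSup (G.welfare '' G.jointActions)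

end Game

/-- The class of games induced by a set of welfare rules and a utility design. Games whose welfare
is not positive anywhere, for which the efficiency ratio is meaningless, are not in it. -/
def gameClass (𝒲 : Set WelfareRule) (𝒰 : UtilityDesign 𝒲) : Set Game :=
  {G | (∀ r, ∃ h : G.w r ∈ 𝒲, G.f r = 𝒰 ⟨G.w r, h⟩) ∧ ∃ a ∈ G.jointActions, 0 < G.welfare a}

/-- The guarantee of a design: the infimum of the `k`-round efficiency over its class of games. -/
noncomputable def classEfficiency (𝒲 : Set WelfareRule) (𝒰 : UtilityDesign 𝒲) (k : ℕ) : ℝ :=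
  sInf ((fun G : Game => G.efficiency k) '' gameClass 𝒲 𝒰)

/-- The optimal guarantee: the supremum over all utility designs. -/
noncomputable def optEfficiency (𝒲 : Set WelfareRule) (k : ℕ) : ℝ :=
  sSup (Set.range fun 𝒰 : UtilityDesign 𝒲 => classEfficiency 𝒲 𝒰 k)

/-- `(f, β)` is feasible for the linear program of the welfare rule `w`. -/
def LPFeasible (w : WelfareRule) (f : UtilityRule) (β : ℝ) : Prop :=
  0 ≤ β ∧ f 1 = 1 ∧
    ∀ y z : ℕ, 1 ≤ y →
      (∑ i ∈ Finset.Icc 1 y, (f i : ℝ)) - z * (f (y + 1) : ℝ) + w z ≤ β * w y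

/-- `(u, β)` is an optimal solution of the linear program of the welfare rule `w`. -/
def IsLPSolution (w : WelfareRule) (u : UtilityRule) (β : ℝ) : Prop :=
  LPFeasible w u β ∧ ∀ f β', LPFeasible w f β' → β ≤ β'

/-- The design sends `∑ α l • w l` to `∑ α l • u l`, with one (arbitrary) representation used for
each welfare rule of the class. If the basis is linearly independent, the representation is unique
and this is the linear design determined by `w l ↦ u l`. -/
def IsLinearDesign {m : ℕ} (w : Fin m → WelfareRule) (u : Fin m → UtilityRule)
    (𝒰 : UtilityDesign (spanned w)) : Prop :=
  ∀ v : spanned w, ∃ α : Fin m → ℝ≥0,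
    (v : WelfareRule) = ∑ l, (α l : ℝ) • w l ∧ 𝒰 v = ∑ l, α l • u l

end ResourceGame

/-!
In a one-round walk the agents that choose a resource receive `f 1, f 2, …` one after the other. If
`f` is nonincreasing, an agent deviating to a resource with final load `y` receives at least
`f (y + 1)`, so that the sum of the best-response inequalities and the constraints of the linear
program bound the optimal welfare by `β` times the welfare of the outcome. These bounds are linear
in the pair of rules, and hence pass to linear designs with the maximum of the values.

Conversely, if no multiple of `f` is feasible for `β`, Farkas' lemma in one unknown yields a finite
family of pairs `(y t, z t)` whose welfare satisfies `∑ w (z t) > β * ∑ w (y t)` although `f` gives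
no incentive to deviate from the loads `y t`. A game with `R` copies of every resource type, in
which the action sets are windows that shift from agent to agent, realizes the ratio of these sums
up to boundary effects that vanish as `R → ∞`.

A nonincreasing optimal rule is obtained by choosing every utility as small as the previous ones
allow. If the resulting total utility minus `β` times the welfare ever increased, it would grow at
least linearly from then on, against the constraints for `z = 0`.
-/

namespace ResourceGame

open Finset Function

/-! ### The linear program -/

section Submodular

variable {w : WelfareRule}

theorem IsSubmodular.monotone (hs : IsSubmodular w) : Monotone w :=
  monotone_nat_of_le_succ hs.1

theorem IsSubmodular.nonneg (hs : IsSubmodular w) (h0 : w 0 = 0) (j : ℕ) : 0 ≤ w j :=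
  h0 ▸ hs.monotone (Nat.zero_le j)

theorem IsSubmodular.apply_add_le (hs : IsSubmodular w) (y k : ℕ) :
    w (y + k) ≤ w y + k * (w (y + 1) - w y) := by
  induction k with
  | zero => simp
  | succ k ih =>
    have hmarginal : w (y + k + 1) - w (y + k) ≤ w (y + 1) - w y := hs.2 (Nat.le_add_right y k)
    rw [← add_assoc]
    push_cast
    linarith

theorem IsSubmodular.le_add_mul (hs : IsSubmodular w) (y z : ℕ) :
    w z ≤ w y + z * (w (y + 1) - w y) :=
  (hs.monotone (Nat.le_add_left z y)).trans (hs.apply_add_le y z)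

theorem IsSubmodular.le_natCast (hs : IsSubmodular w) (h0 : w 0 = 0) (h1 : w 1 = 1) (z : ℕ) :
    w z ≤ z := by
  simpa [h0, h1] using hs.le_add_mul 0 z

end Submodular

section Feasible

variable {w : WelfareRule} {f : UtilityRule} {β β' : ℝ}

/-- The left-hand side of the constraint of the linear program without its welfare term: what `y`
users that join a resource one after the other get in total, minus what `z` users get that each
join as the user number `y + 1`. -/
noncomputable def deviationLoss (f : UtilityRule) (y z : ℕ) : ℝ :=
  (∑ i ∈ Icc 1 y, (f i : ℝ)) - z * (f (y + 1) : ℝ)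

theorem LPFeasible.mono (hf : LPFeasible w f β) (hw : ∀ z, 0 ≤ w z) (hβ : β ≤ β') :
    LPFeasible w f β' :=
  ⟨hf.1.trans hβ, hf.2.1, fun y z hy =>
    (hf.2.2 y z hy).trans (mul_le_mul_of_nonneg_right hβ (hw y))⟩

theorem LPFeasible.one_le (hf : LPFeasible w f β) (h0 : w 0 = 0) (h1 : w 1 = 1) : 1 ≤ β := by
  simpa [h0, h1, hf.2.1] using hf.2.2 1 0 le_rfl

theorem LPFeasible.deviationLoss_add_le (hf : LPFeasible w f β) (h0 : w 0 = 0)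
    (hw : ∀ z : ℕ, w z ≤ z) (y z : ℕ) : deviationLoss f y z + w z ≤ β * w y := by
  rcases Nat.eq_zero_or_pos y with rfl | hy
  · simpa [deviationLoss, hf.2.1, h0] using hw z
  · exact hf.2.2 y z hy

theorem lpFeasible_marginal (hs : IsSubmodular w) (h0 : w 0 = 0) (h1 : w 1 = 1) :
    LPFeasible w (fun i => (w i - w (i - 1)).toNNReal) 2 := by
  have hmarginal : ∀ i, ((w (i + 1) - w i).toNNReal : ℝ) = w (i + 1) - w i := fun i =>
    Real.coe_toNNReal _ (sub_nonneg.2 (hs.1 i))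
  have htelescope : ∀ y, ∑ i ∈ Icc 1 y, ((w i - w (i - 1)).toNNReal : ℝ) = w y := by
    intro y
    induction y with
    | zero => simp [h0]
    | succ y ih =>
      rw [sum_Icc_succ_top (by lia), ih, Nat.add_sub_cancel, hmarginal]
      ring
  refine ⟨zero_le_two, by simp [h0, h1], fun y z _ => ?_⟩
  beta_reduce
  rw [htelescope, Nat.add_sub_cancel, hmarginal]
  linarith [hs.le_add_mul y z]

theorem isClosed_setOf_lpFeasible (w : WelfareRule) :
    IsClosed {p : ℝ × UtilityRule | LPFeasible w p.2 p.1} := by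
  simp only [LPFeasible, Set.ofPred_and, Set.ofPred_forall]
  refine (isClosed_le (by fun_prop) (by fun_prop)).inter
    ((isClosed_eq (by fun_prop) (by fun_prop)).inter ?_)
  exact isClosed_iInter fun y => isClosed_iInter fun z => isClosed_iInter fun _ =>
    isClosed_le (by fun_prop) (by fun_prop)

end Feasible

/-! ### The least feasible utility rule -/

section Greedy

variable {w : WelfareRule} {f : UtilityRule} {β : ℝ}

/-- The least utility of a further user that satisfies the constraints of the linear program when
`e` is the total utility of the current users minus `β` times their welfare. The index is shifted
because the constraint for no deviating user does not involve this utility. -/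
noncomputable def greedyUtility (w : WelfareRule) (e : ℝ) : ℝ :=
  ⨆ z : ℕ, (e + w (z + 1)) / (z + 1)

theorem bddAbove_greedyUtility (hw : ∀ z : ℕ, w z ≤ z) (e : ℝ) :
    BddAbove (Set.range fun z : ℕ => (e + w (z + 1)) / ((z : ℝ) + 1)) := by
  refine ⟨|e| + 1, ?_⟩
  rintro _ ⟨z, rfl⟩
  have hwz : w (z + 1) ≤ z + 1 := mod_cast hw (z + 1)
  have hez : 0 ≤ |e| * z := by positivity
  exact (div_le_iff₀ (by positivity)).2 (by linarith [le_abs_self e])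

theorem add_le_mul_greedyUtility (hw : ∀ z : ℕ, w z ≤ z) (e : ℝ) (z : ℕ) :
    e + w (z + 1) ≤ (z + 1 : ℕ) * greedyUtility w e := by
  have h := le_ciSup (bddAbove_greedyUtility hw e) z
  rw [div_le_iff₀ (by positivity)] at h
  rwa [Nat.cast_succ, mul_comm]

theorem greedyUtility_mono (hw : ∀ z : ℕ, w z ≤ z) : Monotone (greedyUtility w) := fun _ e' h =>
  ciSup_mono (bddAbove_greedyUtility hw e') fun z => by gcongr

theorem greedyUtility_zero (hw : ∀ z : ℕ, w z ≤ z) (h1 : w 1 = 1) : greedyUtility w 0 = 1 := by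
  refine le_antisymm (ciSup_le fun z => ?_) ?_
  · rw [zero_add, div_le_one (by positivity)]
    exact mod_cast hw (z + 1)
  · simpa [h1] using add_le_mul_greedyUtility hw 0 0

theorem greedyUtility_nonneg (hw : ∀ z : ℕ, w z ≤ z) (hn : ∀ z, 0 ≤ w z) (e : ℝ) :
    0 ≤ greedyUtility w e := by
  have hlim : Filter.Tendsto (fun z : ℕ => e / ((z : ℝ) + 1)) Filter.atTop (nhds 0) :=
    tendsto_const_nhds.div_atTop
      (Filter.tendsto_atTop_add_const_right _ _ tendsto_natCast_atTop_atTop)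
  refine le_of_tendsto' hlim fun z => le_trans ?_ (le_ciSup (bddAbove_greedyUtility hw e) z)
  gcongr
  exact le_add_of_nonneg_right (hn (z + 1))

/-- The total utility of `y` users under the greedy rule minus `β` times their welfare. -/
noncomputable def greedyExcess (w : WelfareRule) (β : ℝ) : ℕ → ℝ
  | 0 => 0
  | y + 1 => greedyExcess w β y + greedyUtility w (greedyExcess w β y) - β * (w (y + 1) - w y)

/-- The greedy rule: every utility is the least one that the constraints for the value `β` allow
after the previous ones. It is the candidate for a nonincreasing feasible rule. -/
noncomputable def greedyRule (w : WelfareRule) (β : ℝ) : UtilityRule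
  | 0 => 0
  | y + 1 => (greedyUtility w (greedyExcess w β y)).toNNReal

theorem coe_greedyRule_succ (hw : ∀ z : ℕ, w z ≤ z) (hn : ∀ z, 0 ≤ w z) (β : ℝ) (y : ℕ) :
    (greedyRule w β (y + 1) : ℝ) = greedyUtility w (greedyExcess w β y) :=
  Real.coe_toNNReal _ (greedyUtility_nonneg hw hn _)

theorem greedyRule_one (hw : ∀ z : ℕ, w z ≤ z) (h1 : w 1 = 1) (β : ℝ) : greedyRule w β 1 = 1 := by
  simp [greedyRule, greedyExcess, greedyUtility_zero hw h1]

theorem sum_greedyRule (hw : ∀ z : ℕ, w z ≤ z) (hn : ∀ z, 0 ≤ w z) (h0 : w 0 = 0) (β : ℝ)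
    (y : ℕ) : ∑ i ∈ Icc 1 y, (greedyRule w β i : ℝ) = greedyExcess w β y + β * w y := by
  induction y with
  | zero => simp [greedyExcess, h0]
  | succ y ih =>
    rw [sum_Icc_succ_top (by lia), ih, coe_greedyRule_succ hw hn, greedyExcess]
    ring

theorem LPFeasible.greedyExcess_le (hf : LPFeasible w f β) (hw : ∀ z : ℕ, w z ≤ z)
    (h0 : w 0 = 0) (y : ℕ) : greedyExcess w β y ≤ (∑ i ∈ Icc 1 y, (f i : ℝ)) - β * w y := by
  induction y with
  | zero => simp [greedyExcess, h0]
  | succ y ih =>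
    have hnext : greedyUtility w (greedyExcess w β y) ≤ f (y + 1) := by
      refine ciSup_le fun z => (div_le_iff₀ (by positivity)).2 ?_
      have hz := hf.deviationLoss_add_le h0 hw y (z + 1)
      rw [deviationLoss, Nat.cast_succ] at hz
      linarith
    rw [sum_Icc_succ_top (by lia), greedyExcess]
    linarith

theorem LPFeasible.greedyExcess_nonpos (hf : LPFeasible w f β) (hw : ∀ z : ℕ, w z ≤ z)
    (h0 : w 0 = 0) (y : ℕ) : greedyExcess w β y ≤ 0 := by
  have hz := hf.deviationLoss_add_le h0 hw y 0
  rw [deviationLoss, h0, Nat.cast_zero] at hz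
  linarith [hf.greedyExcess_le hw h0 y]

-- A single increase would force all later increments to be at least as large.
theorem antitone_of_bddAbove_of_succ_sub_eq {e : ℕ → ℝ} {φ : ℝ → ℝ} {ψ : ℕ → ℝ}
    (hφ : Monotone φ) (hψ : Monotone ψ) (he : ∀ n, e (n + 1) - e n = φ (e n) + ψ n)
    (hbdd : BddAbove (Set.range e)) : Antitone e := by
  refine antitone_nat_of_succ_le fun n => ?_
  by_contra! hlt
  set δ := e (n + 1) - e n
  have hδ0 : 0 < δ := sub_pos.2 hlt
  have hstep : ∀ k, δ ≤ e (n + k + 1) - e (n + k) := by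
    intro k
    induction k with
    | zero => exact le_rfl
    | succ k ih =>
      have hφk := hφ (show e (n + k) ≤ e (n + k + 1) by linarith)
      have hψk := hψ (Nat.le_succ (n + k))
      have he₀ := he (n + k)
      have he₁ := he (n + k + 1)
      rw [← add_assoc]
      linarith
  have hgrowth : ∀ k : ℕ, e n + k * δ ≤ e (n + k) := by
    intro k
    induction k with
    | zero => simp
    | succ k ih =>
      rw [← add_assoc]
      push_cast
      linarith [hstep k]
  obtain ⟨B, hB⟩ := hbdd
  obtain ⟨k, hk⟩ := exists_nat_gt ((B - e n) / δ)
  rw [div_lt_iff₀ hδ0] at hk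
  linarith [hgrowth k, hB (Set.mem_range_self (n + k))]

theorem LPFeasible.greedyExcess_antitone (hf : LPFeasible w f β) (hs : IsSubmodular w)
    (h0 : w 0 = 0) (h1 : w 1 = 1) : Antitone (greedyExcess w β) := by
  have hw := hs.le_natCast h0 h1
  refine antitone_of_bddAbove_of_succ_sub_eq (greedyUtility_mono hw)
    (ψ := fun y => -(β * (w (y + 1) - w y)))
    (fun _ _ h => neg_le_neg (mul_le_mul_of_nonneg_left (hs.2 h) hf.1)) (fun y => ?_)
    ⟨0, Set.forall_mem_range.2 (hf.greedyExcess_nonpos hw h0)⟩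
  rw [greedyExcess]
  ring

theorem LPFeasible.greedyRule_antitoneOn (hf : LPFeasible w f β) (hs : IsSubmodular w)
    (h0 : w 0 = 0) (h1 : w 1 = 1) : AntitoneOn (greedyRule w β) (Set.Ici 1) := by
  rintro (_ | i) hi (_ | j) hj hij
  any_goals simp at hi hj
  exact Real.toNNReal_le_toNNReal <| greedyUtility_mono (hs.le_natCast h0 h1) <|
    hf.greedyExcess_antitone hs h0 h1 (Nat.le_of_succ_le_succ hij)

theorem LPFeasible.greedyRule_le_one (hf : LPFeasible w f β) (hs : IsSubmodular w)
    (h0 : w 0 = 0) (h1 : w 1 = 1) : greedyRule w β ≤ 1 := by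
  rintro (_ | i)
  · exact zero_le_one
  · exact (hf.greedyRule_antitoneOn hs h0 h1 Set.self_mem_Ici (by simp) (by simp)).trans_eq
      (greedyRule_one (hs.le_natCast h0 h1) h1 β)

theorem LPFeasible.lpFeasible_greedyRule (hf : LPFeasible w f β) (hw : ∀ z : ℕ, w z ≤ z)
    (hn : ∀ z, 0 ≤ w z) (h0 : w 0 = 0) (h1 : w 1 = 1) : LPFeasible w (greedyRule w β) β := by
  refine ⟨hf.1, greedyRule_one hw h1 β, fun y z _ => ?_⟩
  rw [sum_greedyRule hw hn h0, coe_greedyRule_succ hw hn]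
  rcases z with _ | z
  · simpa [h0] using hf.greedyExcess_nonpos hw h0 y
  · linarith [add_le_mul_greedyUtility hw (greedyExcess w β y) z]

theorem exists_isLPSolution_antitoneOn (hs : IsSubmodular w) (h0 : w 0 = 0) (h1 : w 1 = 1) :
    ∃ β : ℝ, ∃ u : UtilityRule, IsLPSolution w u β ∧ AntitoneOn u (Set.Ici 1) := by
  have hw := hs.le_natCast h0 h1
  have hn := hs.nonneg h0
  let K : Set (ℝ × UtilityRule) :=
    (Set.Icc 0 2 ×ˢ Set.Icc 0 1) ∩ {p | LPFeasible w p.2 p.1}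
  have hK : IsCompact K :=
    (isCompact_Icc.prod isCompact_Icc).inter_right (isClosed_setOf_lpFeasible w)
  have hgreedy : ∀ {f β}, LPFeasible w f β → β ≤ 2 → (β, greedyRule w β) ∈ K :=
    fun hf hβ => ⟨⟨⟨hf.1, hβ⟩, fun _ => zero_le, hf.greedyRule_le_one hs h0 h1⟩,
      hf.lpFeasible_greedyRule hw hn h0 h1⟩
  obtain ⟨⟨β, f⟩, ⟨⟨⟨-, hβ2⟩, -⟩, hf⟩, hmin⟩ := hK.exists_isMinOn
    ⟨_, hgreedy (lpFeasible_marginal hs h0 h1) le_rfl⟩ continuous_fst.continuousOn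
  refine ⟨β, _, ⟨hf.lpFeasible_greedyRule hw hn h0 h1, fun f' β' hf' => ?_⟩,
    hf.greedyRule_antitoneOn hs h0 h1⟩
  rcases le_total β' 2 with hβ' | hβ'
  · exact hmin (hgreedy hf' hβ')
  · exact hβ2.trans hβ'

end Greedy

/-! ### Duality for a fixed utility rule -/

section Duality

theorem div_le_div_of_forall_natCast {d d' e e' : ℝ} (hd : d < 0) (hd' : 0 < d')
    (H : ∀ a b : ℕ, 0 ≤ a * d + b * d' → 0 ≤ a * e + b * e') : e / d ≤ e' / d' := by
  have he' : 0 ≤ e' := by simpa using H 0 1 (by simpa using hd'.le)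
  have hratio : 0 ≤ -d / d' := div_nonneg (neg_nonneg.2 hd.le) hd'.le
  have hlim : ∀ k : ℕ, k * (-(e + -d / d' * e')) ≤ e' := by
    intro k
    set b := ⌈k * (-d / d')⌉₊
    have hb : k * (-d / d') ≤ b := Nat.le_ceil _
    have hb' : b ≤ k * (-d / d') + 1 := (Nat.ceil_lt_add_one (by positivity)).le
    have hcomb : 0 ≤ k * d + b * d' := by
      have h := mul_le_mul_of_nonneg_right hb hd'.le
      have hcancel : k * (-d / d') * d' = -(k * d) := by field_simp
      linarith
    linarith [H k b hcomb, mul_le_mul_of_nonneg_right hb' he']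
  have hcross : 0 ≤ e + -d / d' * e' := by
    by_contra! hneg
    obtain ⟨k, hk⟩ := exists_nat_gt (e' / (-(e + -d / d' * e')))
    rw [div_lt_iff₀ (neg_pos.2 hneg)] at hk
    exact (hlim k).not_gt hk
  rw [div_le_iff_of_neg hd]
  linear_combination hcross

-- Farkas' lemma in one unknown: the lower bounds `E p / D p` for `D p < 0` lie below the upper
-- bounds `E q / D q` for `0 < D q`.
theorem exists_nonneg_forall_mul_le {ι : Type*} {D E : ι → ℝ}
    (H : ∀ (T : ℕ) (p : Fin T → ι), 0 ≤ ∑ t, D (p t) → 0 ≤ ∑ t, E (p t))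
    {p₀ : ι} (hp₀ : 0 < D p₀) : ∃ c : ℝ, 0 ≤ c ∧ ∀ p, c * D p ≤ E p := by
  have hE : ∀ p, 0 ≤ D p → 0 ≤ E p := fun p hp => by simpa using H 1 (fun _ => p) (by simpa)
  have hcross : ∀ p q, D p < 0 → 0 < D q → E p / D p ≤ E q / D q := fun p q hp hq =>
    div_le_div_of_forall_natCast hp hq fun a b hab => by
      simpa [Fin.sum_univ_add] using H (a + b) (Fin.append (fun _ => p) fun _ => q)
        (by simpa [Fin.sum_univ_add] using hab)
  obtain ⟨c, hlower, hupper⟩ := exists_between_of_forall_le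
    (s := insert 0 ((fun p => E p / D p) '' {p | D p < 0}))
    (t := (fun q => E q / D q) '' {q | 0 < D q}) (Set.insert_nonempty _ _)
    ⟨_, Set.mem_image_of_mem _ hp₀⟩ (by
      rintro _ (rfl | ⟨p, hp, rfl⟩) _ ⟨q, hq, rfl⟩
      · exact div_nonneg (hE q (le_of_lt hq)) (le_of_lt hq)
      · exact hcross p q hp hq)
  refine ⟨c, hlower (Set.mem_insert _ _), fun p => ?_⟩
  rcases lt_trichotomy (D p) 0 with hp | hp | hp
  · exact (div_le_iff_of_neg hp).1 (hlower (Set.mem_insert_of_mem _ ⟨p, hp, rfl⟩))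
  · simpa [hp] using hE p hp.ge
  · exact (le_div_iff₀ hp).1 (hupper ⟨p, hp, rfl⟩)

variable {w : WelfareRule} {f : UtilityRule} {β : ℝ}

-- The constraint for `y = 0`, `z = 1` gives `1 ≤ c * f 1`, so replacing `c * f 1` by `1` only
-- decreases the left-hand sides of the constraints of the program.
theorem lpFeasible_update_smul (h0 : w 0 = 0) (h1 : w 1 = 1) (hβ : 0 ≤ β) {c : ℝ≥0}
    (hc : ∀ y z, c * deviationLoss f y z ≤ β * w y - w z) :
    LPFeasible w (update (c • f) 1 1) β := by
  have hc1 : 1 ≤ (c : ℝ) * f 1 := by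
    have h := hc 0 1
    simp only [deviationLoss, zero_lt_one, Icc_eq_empty_of_lt, sum_empty, Nat.cast_one, zero_add,
      one_mul, zero_sub, h0, h1] at h
    linarith
  refine ⟨hβ, by simp, fun y z hy => ?_⟩
  have hsum : ∑ i ∈ Icc 1 y, (update (c • f) 1 1 i : ℝ) ≤ c * ∑ i ∈ Icc 1 y, (f i : ℝ) := by
    rw [mul_sum]
    refine sum_le_sum fun i _ => ?_
    rcases eq_or_ne i 1 with rfl | hi
    · simpa using hc1
    · simp [update_of_ne hi]
  have h := hc y z
  rw [deviationLoss] at h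
  rw [update_of_ne (by lia), Pi.smul_apply, smul_eq_mul, NNReal.coe_mul]
  linarith

theorem exists_lpFeasible_of_forall_sum_le (h0 : w 0 = 0) (h1 : w 1 = 1) (hβ : 0 ≤ β)
    (H : ∀ (T : ℕ) (y z : Fin T → ℕ), 0 ≤ ∑ t, deviationLoss f (y t) (z t) →
      ∑ t, w (z t) ≤ β * ∑ t, w (y t)) : ∃ F : UtilityRule, LPFeasible w F β := by
  have hf1 : 0 < (f 1 : ℝ) := by
    refine lt_of_le_of_ne (f 1).2 fun hzero => ?_
    have := H 1 (fun _ => 0) (fun _ => 1) (by simp [deviationLoss, ← hzero])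
    norm_num [h0, h1] at this
  obtain ⟨c, hc, hcD⟩ := exists_nonneg_forall_mul_le
    (D := fun p : ℕ × ℕ => deviationLoss f p.1 p.2) (E := fun p => β * w p.1 - w p.2)
    (fun T p hp => by
      rw [sum_sub_distrib, ← mul_sum, sub_nonneg]
      exact H T (fun t => (p t).1) (fun t => (p t).2) hp)
    (p₀ := (1, 0)) (by simpa [deviationLoss] using hf1)
  lift c to ℝ≥0 using hc
  exact ⟨_, lpFeasible_update_smul h0 h1 hβ fun y z => hcD (y, z)⟩

end Duality

/-! ### Walks -/

namespace Game

variable {G : Game}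

/-- The profile in which the agents before `τ` play as in `s` and the others have not moved: the
state at time `τ` of a one-round walk with outcome `s`. -/
def truncate (s : G.Profile) (τ : ℕ) : G.Profile := fun i => if (i : ℕ) < τ then s i else ∅

/-- The number of agents before `i` that use the resource `r`; it is the load that `i` finds in a
one-round walk with outcome `s`. -/
def loadBefore (s : G.Profile) (i : Fin G.n) (r : Fin G.c) : ℕ :=
  #{j | j < i ∧ r ∈ s j}

theorem truncate_zero (s : G.Profile) : truncate s 0 = fun _ => ∅ :=
  funext fun i => by simp [truncate]

theorem truncate_n (s : G.Profile) : truncate s G.n = s :=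
  funext fun i => by simp [truncate]

theorem truncate_update_of_le (s : G.Profile) (i : Fin G.n) (b : Finset (Fin G.c)) {τ : ℕ}
    (hτ : τ ≤ i) : truncate (update s i b) τ = truncate s τ := by
  ext j : 1
  by_cases hj : (j : ℕ) < τ
  · simp [truncate, hj, update_of_ne (show j ≠ i by grind)]
  · simp [truncate, hj]

theorem truncate_update_succ (s : G.Profile) (i : Fin G.n) (b : Finset (Fin G.c)) :
    truncate (update s i b) (i + 1) = update (truncate s i) i b := by
  ext j : 1
  rcases eq_or_ne j i with rfl | hj
  · simp [truncate]
  · have hlt : (j : ℕ) < i + 1 ↔ (j : ℕ) < i := by grind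
    simp [truncate, hj, hlt]

theorem update_truncate (s : G.Profile) (i : Fin G.n) :
    update (truncate s i) i (s i) = truncate s (i + 1) := by
  rw [← truncate_update_succ, update_eq_self]

theorem IsWalk.exists_step {a : ℕ → G.Profile} (ha : G.IsWalk 1 a) (i : Fin G.n) :
    ∃ b ∈ G.bestResponses i (a i), a (i + 1) = update (a i) i b :=
  ha.2 i (by simp) i (Nat.mod_eq_of_lt i.2).symm

theorem IsWalk.truncate_self {a : ℕ → G.Profile} (ha : G.IsWalk 1 a) {τ : ℕ} (hτ : τ ≤ G.n) :
    truncate (a τ) τ = a τ := by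
  induction τ with
  | zero => rw [truncate_zero, ha.1]
  | succ τ ih =>
    obtain ⟨b, -, hb⟩ := ha.exists_step ⟨τ, hτ⟩
    rw [hb, truncate_update_succ _ ⟨τ, hτ⟩, ih (Nat.le_of_succ_le hτ)]

theorem IsWalk.truncate_eq {a : ℕ → G.Profile} (ha : G.IsWalk 1 a) {τ σ : ℕ} (hτσ : τ ≤ σ)
    (hσ : σ ≤ G.n) : truncate (a σ) τ = a τ := by
  induction σ, hτσ using Nat.le_induction with
  | base => exact ha.truncate_self hσ
  | succ σ hτσ ih =>
    obtain ⟨b, -, hb⟩ := ha.exists_step ⟨σ, hσ⟩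
    rw [hb, truncate_update_of_le _ _ _ hτσ, ih (Nat.le_of_succ_le hσ)]

theorem mem_sol_one {s : G.Profile} :
    s ∈ G.sol 1 ↔ ∀ i, s i ∈ G.bestResponses i (truncate s i) := by
  constructor
  · rintro ⟨a, ha, rfl⟩ i
    rw [one_mul]
    obtain ⟨b, hb, hstep⟩ := ha.exists_step i
    have hmove : a G.n i = b := by
      simpa [truncate, hstep] using congrFun (ha.truncate_eq (Nat.succ_le_of_lt i.2) le_rfl) i
    rwa [ha.truncate_eq i.2.le le_rfl, hmove]
  · intro h
    refine ⟨truncate s, ⟨truncate_zero s, fun τ hτ i hi => ?_⟩, by rw [one_mul, truncate_n]⟩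
    rw [one_mul] at hτ
    obtain rfl : (i : ℕ) = τ := hi.trans (Nat.mod_eq_of_lt hτ)
    exact ⟨s i, h i, (update_truncate s i).symm⟩

theorem bestResponses_nonempty (i : Fin G.n) (a : G.Profile) : (G.bestResponses i a).Nonempty :=
  (G.actions i).exists_max_image (fun b => G.utility i (update a i b)) (G.actions_nonempty i)

theorem sol_nonempty (G : Game) (k : ℕ) : (G.sol k).Nonempty := by
  choose reply hreply using fun (i : Fin G.n) a => bestResponses_nonempty i a
  let a : ℕ → G.Profile := fun τ => Nat.rec (fun _ => ∅) (fun τ s => if h : 0 < G.n then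
    update s ⟨τ % G.n, Nat.mod_lt τ h⟩ (reply ⟨τ % G.n, Nat.mod_lt τ h⟩ s) else s) τ
  refine ⟨_, a, ⟨rfl, fun τ _ i hi => ⟨reply i (a τ), hreply _ _, ?_⟩⟩, rfl⟩
  have hmod : i = ⟨τ % G.n, Nat.mod_lt τ i.pos⟩ := Fin.ext hi
  rw [hmod]
  exact dif_pos i.pos

theorem load_update_truncate (s : G.Profile) (i : Fin G.n) {x : Finset (Fin G.c)} {r : Fin G.c}
    (hr : r ∈ x) : G.load (update (truncate s i) i x) r = loadBefore s i r + 1 := by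
  rw [load, loadBefore, ← card_insert_of_notMem (a := i) (by simp)]
  congr 1
  ext j
  rcases eq_or_ne j i with rfl | hji
  · simp [hr]
  · by_cases hlt : j < i <;> simp [truncate, hji, hlt]

theorem utility_update_truncate (s : G.Profile) (i : Fin G.n) (x : Finset (Fin G.c)) :
    G.utility i (update (truncate s i) i x) = ∑ r ∈ x, (G.f r (loadBefore s i r + 1) : ℝ) := by
  rw [utility, update_self]
  exact sum_congr rfl fun r hr => by rw [load_update_truncate s i hr]

/-! ### Welfare and efficiency -/

theorem welfare_eq_sum (h0 : ∀ r, G.w r 0 = 0) (a : G.Profile) :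
    G.welfare a = ∑ r, G.w r (G.load a r) := by
  refine sum_subset (subset_univ _) fun r _ hr => ?_
  have hload : G.load a r = 0 := by simpa [load, filter_eq_empty_iff] using hr
  rw [hload, h0]

theorem welfare_nonneg (hn : ∀ r j, 0 ≤ G.w r j) (a : G.Profile) : 0 ≤ G.welfare a :=
  sum_nonneg fun r _ => hn r _

theorem efficiency_nonneg (hn : ∀ r j, 0 ≤ G.w r j) (k : ℕ) : 0 ≤ G.efficiency k :=
  div_nonneg (Real.sInf_nonneg (Set.forall_mem_image.2 fun a _ => welfare_nonneg hn a))
    (Real.sSup_nonneg (Set.forall_mem_image.2 fun a _ => welfare_nonneg hn a))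

theorem welfare_le_sSup {o : G.Profile} (ho : o ∈ G.jointActions) :
    G.welfare o ≤ sSup (G.welfare '' G.jointActions) :=
  le_csSup (Set.toFinite _).bddAbove (Set.mem_image_of_mem _ ho)

theorem one_div_le_efficiency {k : ℕ} {β : ℝ} (hβ : 0 < β)
    (h : ∀ s ∈ G.sol k, ∀ o ∈ G.jointActions, G.welfare o ≤ β * G.welfare s)
    (hpos : ∃ a ∈ G.jointActions, 0 < G.welfare a) : 1 / β ≤ G.efficiency k := by
  obtain ⟨a, ha, ha0⟩ := hpos
  rw [efficiency, div_le_div_iff₀ hβ (ha0.trans_le (welfare_le_sSup ha)), one_mul]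
  refine csSup_le ⟨_, Set.mem_image_of_mem _ ha⟩ (Set.forall_mem_image.2 fun o ho => ?_)
  rw [← div_le_iff₀ hβ]
  refine le_csInf ((sol_nonempty G k).image _) (Set.forall_mem_image.2 fun s hs => ?_)
  exact (div_le_iff₀' hβ).2 (h s hs o ho)

theorem efficiency_le_one_div {k : ℕ} {β : ℝ} (hβ : 0 < β) {s o : G.Profile} (hs : s ∈ G.sol k)
    (ho : o ∈ G.jointActions) (hpos : 0 < G.welfare o) (h : β * G.welfare s ≤ G.welfare o) :
    G.efficiency k ≤ 1 / β := by
  have hinf : sInf (G.welfare '' G.sol k) ≤ G.welfare s :=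
    csInf_le (Set.toFinite _).bddBelow (Set.mem_image_of_mem _ hs)
  rw [efficiency, div_le_div_iff₀ (hpos.trans_le (welfare_le_sSup ho)) hβ, one_mul, mul_comm]
  exact (mul_le_mul_of_nonneg_left hinf hβ.le).trans (h.trans (welfare_le_sSup ho))

end Game

/-! ### Smoothness -/

theorem sum_card_filter_lt_add_one {α M : Type*} [LinearOrder α] [AddCommMonoid M]
    (S : Finset α) (g : ℕ → M) :
    ∑ i ∈ S, g (#{j ∈ S | j < i} + 1) = ∑ k ∈ Icc 1 #S, g k := by
  induction S using Finset.induction_on_max with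
  | empty => simp
  | insert a S ha ih =>
    have hna : a ∉ S := fun h => lt_irrefl _ (ha a h)
    rw [sum_insert hna, card_insert_of_notMem hna, sum_Icc_succ_top (by lia), ← ih, add_comm]
    congr 1
    · exact sum_congr rfl fun i hi => by rw [filter_insert, if_neg (ha i hi).not_gt]
    · rw [filter_insert, if_neg (lt_irrefl _), filter_true_of_mem ha]

/-- A welfare rule and a utility rule for which summing the best-response inequalities of a
one-round walk bounds the optimal welfare by `β` times the welfare of the outcome. -/
structure IsSmooth (w : WelfareRule) (f : UtilityRule) (β : ℝ) : Prop where
  apply_zero : w 0 = 0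
  antitoneOn : AntitoneOn f (Set.Ici 1)
  deviationLoss_add_le : ∀ y z : ℕ, deviationLoss f y z + w z ≤ β * w y

theorem LPFeasible.isSmooth {w : WelfareRule} {f : UtilityRule} {β : ℝ} (hf : LPFeasible w f β)
    (h0 : w 0 = 0) (hw : ∀ z : ℕ, w z ≤ z) (hanti : AntitoneOn f (Set.Ici 1)) :
    IsSmooth w f β :=
  ⟨h0, hanti, hf.deviationLoss_add_le h0 hw⟩

theorem deviationLoss_sum_smul {ι : Type*} (S : Finset ι) (α : ι → ℝ≥0) (f : ι → UtilityRule)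
    (y z : ℕ) :
    deviationLoss (∑ l ∈ S, α l • f l) y z = ∑ l ∈ S, (α l : ℝ) * deviationLoss (f l) y z := by
  simp only [deviationLoss, Finset.sum_apply, Pi.smul_apply, smul_eq_mul, NNReal.coe_sum,
    NNReal.coe_mul, mul_sub, mul_sum, sum_sub_distrib]
  rw [sum_comm]
  simp only [mul_left_comm]

theorem IsSmooth.sum_smul {ι : Type*} {S : Finset ι} {w : ι → WelfareRule} {f : ι → UtilityRule}
    {β : ℝ} (h : ∀ l ∈ S, IsSmooth (w l) (f l) β) (α : ι → ℝ≥0) :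
    IsSmooth (∑ l ∈ S, (α l : ℝ) • w l) (∑ l ∈ S, α l • f l) β where
  apply_zero := by
    rw [Finset.sum_apply]
    exact sum_eq_zero fun l hl => by simp [(h l hl).apply_zero]
  antitoneOn i hi j hj hij := by
    simp only [Finset.sum_apply, Pi.smul_apply, smul_eq_mul]
    gcongr with l hl
    exact (h l hl).antitoneOn hi hj hij
  deviationLoss_add_le y z := by
    simp only [deviationLoss_sum_smul, Finset.sum_apply, Pi.smul_apply, smul_eq_mul, mul_sum,
      ← sum_add_distrib, ← mul_add, mul_left_comm β]
    gcongr with l hl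
    exact (h l hl).deviationLoss_add_le y z

namespace Game

variable {G : Game}

theorem sum_sum_eq_sum_sum_filter {M : Type*} [AddCommMonoid M] (s : G.Profile)
    (g : Fin G.n → Fin G.c → M) :
    ∑ i, ∑ r ∈ s i, g i r = ∑ r, ∑ i with r ∈ s i, g i r :=
  sum_comm' (by simp)

theorem sum_loadBefore (s : G.Profile) :
    ∑ i, ∑ r ∈ s i, (G.f r (loadBefore s i r + 1) : ℝ) =
      ∑ r, ∑ k ∈ Icc 1 (G.load s r), (G.f r k : ℝ) := by
  rw [sum_sum_eq_sum_sum_filter]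
  refine sum_congr rfl fun r _ => ?_
  rw [load, ← sum_card_filter_lt_add_one _ fun k => (G.f r k : ℝ)]
  simp only [loadBefore, filter_filter, and_comm]

theorem loadBefore_le_load (s : G.Profile) (i : Fin G.n) (r : Fin G.c) :
    loadBefore s i r ≤ G.load s r :=
  card_le_card (monotone_filter_right _ fun _ _ h => h.2)

theorem sum_load_mul_le (hanti : ∀ r, AntitoneOn (G.f r) (Set.Ici 1)) (s o : G.Profile) :
    ∑ r, G.load o r * (G.f r (G.load s r + 1) : ℝ) ≤
      ∑ i, ∑ r ∈ o i, (G.f r (loadBefore s i r + 1) : ℝ) := by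
  rw [sum_sum_eq_sum_sum_filter]
  refine sum_le_sum fun r _ => ?_
  rw [load, ← nsmul_eq_mul, ← sum_const]
  refine sum_le_sum fun i _ => NNReal.coe_le_coe.2 (hanti r ?_ ?_ ?_)
  · simp
  · simp
  · exact Nat.succ_le_succ (loadBefore_le_load s i r)

theorem welfare_le_mul_welfare {β : ℝ} (hsmooth : ∀ r, IsSmooth (G.w r) (G.f r) β)
    {s o : G.Profile} (hs : s ∈ G.sol 1) (ho : o ∈ G.jointActions) :
    G.welfare o ≤ β * G.welfare s := by
  have hbest : ∑ i, ∑ r ∈ o i, (G.f r (loadBefore s i r + 1) : ℝ) ≤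
      ∑ i, ∑ r ∈ s i, (G.f r (loadBefore s i r + 1) : ℝ) := by
    refine sum_le_sum fun i _ => ?_
    simpa only [utility_update_truncate] using (mem_sol_one.1 hs i).2 (o i) (ho i)
  have hloss : 0 ≤ ∑ r, deviationLoss (G.f r) (G.load s r) (G.load o r) := by
    simp only [deviationLoss, sum_sub_distrib, sub_nonneg]
    exact (sum_load_mul_le (fun r => (hsmooth r).antitoneOn) s o).trans
      (hbest.trans_eq (sum_loadBefore s))
  have hsum := sum_le_sum fun r (_ : r ∈ univ) =>
    (hsmooth r).deviationLoss_add_le (G.load s r) (G.load o r)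
  rw [sum_add_distrib, ← mul_sum] at hsum
  have hzero : ∀ r, G.w r 0 = 0 := fun r => (hsmooth r).apply_zero
  rw [welfare_eq_sum hzero, welfare_eq_sum hzero]
  linarith

end Game

/-! ### Inefficient games -/

section WindowGame

variable {T R : ℕ}

theorem sum_divNat_modNat {M : Type*} [AddCommMonoid M] (g : Fin R → Fin T → M) :
    ∑ r : Fin (R * T), g r.divNat r.modNat = ∑ ρ, ∑ t, g ρ t :=
  (finProdFinEquiv.symm.sum_comp fun p : Fin R × Fin T => g p.1 p.2).trans
    (Fintype.sum_prod_type' g)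

theorem divNat_finProdFinEquiv (p : Fin R × Fin T) : (finProdFinEquiv p).divNat = p.1 :=
  congrArg Prod.fst (finProdFinEquiv.symm_apply_apply p)

theorem modNat_finProdFinEquiv (p : Fin R × Fin T) : (finProdFinEquiv p).modNat = p.2 :=
  congrArg Prod.snd (finProdFinEquiv.symm_apply_apply p)

theorem card_filter_le_and_lt (n a b : ℕ) :
    #{i : Fin n | a ≤ i ∧ (i : ℕ) < b} = min b n - a := by
  rw [← Nat.card_Ico, ← card_map Fin.valEmbedding]
  congr 1
  ext k
  simp only [mem_map, mem_filter, mem_univ, true_and, Fin.valEmbedding_apply, mem_Ico]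
  exact ⟨by grind, fun hk => ⟨⟨k, by grind⟩, by grind, rfl⟩⟩

/-- The resources `Fin (R * T)` are arranged in `R` rows (`Fin.divNat`), each with one resource of
every type in `Fin T` (`Fin.modNat`). The window of the agent `i` consists of the resources of type
`t` in the `x t` rows that end with the row `i - d`, so that a resource of type `t` in row `ρ` is
used by the agents `ρ + d, …, ρ + d + x t - 1`. -/
def window (x : Fin T → ℕ) (d : ℕ) (i : Fin R) : Finset (Fin (R * T)) :=
  {r | (r.divNat : ℕ) + d ≤ i ∧ (i : ℕ) < r.divNat + d + x r.modNat}

theorem mem_window {x : Fin T → ℕ} {d : ℕ} {i : Fin R} {r : Fin (R * T)} :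
    r ∈ window x d i ↔ (r.divNat : ℕ) + d ≤ i ∧ (i : ℕ) < r.divNat + d + x r.modNat := by
  rw [window, mem_filter_univ]

theorem sum_window {M : Type*} [AddCommMonoid M] (x : Fin T → ℕ) (d : ℕ) (i : Fin R)
    (g : ℕ → Fin T → M) :
    ∑ r ∈ window x d i, g (i - d - (r.divNat : Fin R)) r.modNat =
      ∑ t, ∑ k ∈ range (min (x t) (i + 1 - d)), g k t := by
  rw [sum_sigma']
  refine sum_nbij' (fun r => ⟨r.modNat, i - d - (r.divNat : Fin R)⟩)
    (fun p => finProdFinEquiv (⟨i - d - p.2, by lia⟩, p.1)) ?_ ?_ ?_ ?_ ?_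
  · intro r hr
    rw [mem_window] at hr
    rw [mem_sigma, mem_range]
    exact ⟨mem_univ _, by dsimp only; lia⟩
  · rintro ⟨t, k⟩ hk
    rw [mem_sigma, mem_range] at hk
    dsimp only at hk
    rw [mem_window, divNat_finProdFinEquiv, modNat_finProdFinEquiv]
    dsimp only
    lia
  · intro r hr
    rw [mem_window] at hr
    have hrow : (i : ℕ) - d - (i - d - (r.divNat : Fin R)) = (r.divNat : Fin R) := by lia
    refine (congrArg finProdFinEquiv ?_).trans (finProdFinEquiv.apply_symm_apply r)
    exact Prod.ext (Fin.ext hrow) rfl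
  · rintro ⟨t, k⟩ hk
    rw [mem_sigma, mem_range] at hk
    simp only [divNat_finProdFinEquiv, modNat_finProdFinEquiv]
    congr 1
    lia
  · exact fun _ _ => rfl

/-- The game in which the agent `i` has the choice between its windows for `(y, 0)` and `(z, K)`,
all resources having the same rules. For `y ≤ K` the second window only holds resources that all
their users in the profile of the first windows have joined before `i`. -/
abbrev windowGame (w : WelfareRule) (f : UtilityRule) (y z : Fin T → ℕ) (K R : ℕ) : Game where
  n := R
  c := R * T
  actions i := {window y 0 i, window z K i}
  actions_nonempty _ := insert_nonempty _ _
  w _ := w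
  f _ := f

variable (w : WelfareRule) (f : UtilityRule) (y z : Fin T → ℕ) {K : ℕ}

theorem load_window (x : Fin T → ℕ) (d : ℕ) (r : Fin (R * T)) :
    (windowGame w f y z K R).load (window x d) r =
      min (r.divNat + d + x r.modNat) R - (r.divNat + d) := by
  simp only [Game.load, mem_window]
  exact card_filter_le_and_lt _ _ _

theorem loadBefore_window (x : Fin T → ℕ) (d : ℕ) (i : Fin R) (r : Fin (R * T)) :
    Game.loadBefore (G := windowGame w f y z K R) (window x d) i r =
      min (r.divNat + d + x r.modNat) i - (r.divNat + d) := by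
  have hcard := card_filter_le_and_lt R (r.divNat + d) (min (r.divNat + d + x r.modNat) i)
  rw [min_eq_left ((min_le_right _ _).trans i.2.le)] at hcard
  rw [Game.loadBefore, ← hcard]
  refine congrArg _ (filter_congr fun j _ => ?_)
  rw [mem_window, Fin.lt_def]
  lia

variable {y z}

theorem sum_window_outcome (hy : ∀ t, y t ≤ K) {i : Fin R} (hi : K ≤ i) :
    ∑ r ∈ window y 0 i, (f (Game.loadBefore (G := windowGame w f y z K R)
      (window y 0) i r + 1) : ℝ) = ∑ t, ∑ k ∈ Icc 1 (y t), (f k : ℝ) := by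
  have hload : ∀ r ∈ window y 0 i, (f (Game.loadBefore (G := windowGame w f y z K R)
      (window y 0) i r + 1) : ℝ) = f (i - 0 - (r.divNat : Fin R) + 1) := fun r hr => by
    rw [mem_window] at hr
    rw [loadBefore_window]
    congr 2
    lia
  rw [sum_congr rfl hload, sum_window y 0 i fun k _ => (f (k + 1) : ℝ)]
  refine sum_congr rfl fun t _ => ?_
  rw [min_eq_left (by have := hy t; lia), range_eq_Ico, sum_Ico_add' (fun k => (f k : ℝ)),
    zero_add, Ico_add_one_right_eq_Icc]

theorem sum_window_deviation_le (hy : ∀ t, y t ≤ K) (i : Fin R) :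
    ∑ r ∈ window z K i, (f (Game.loadBefore (G := windowGame w f y z K R)
      (window y 0) i r + 1) : ℝ) ≤ ∑ t, z t * (f (y t + 1) : ℝ) := by
  have hload : ∀ r ∈ window z K i, (f (Game.loadBefore (G := windowGame w f y z K R)
      (window y 0) i r + 1) : ℝ) = f (y r.modNat + 1) := fun r hr => by
    rw [mem_window] at hr
    rw [loadBefore_window]
    congr 2
    have := hy r.modNat
    lia
  rw [sum_congr rfl hload, sum_window z K i fun _ t => (f (y t + 1) : ℝ)]
  refine sum_le_sum fun t _ => ?_
  rw [sum_const, card_range, nsmul_eq_mul]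
  gcongr
  exact min_le_left _ _

theorem window_mem_sol (hy : ∀ t, y t ≤ K) (hf : 0 ≤ ∑ t, deviationLoss f (y t) (z t)) :
    window y 0 ∈ (windowGame w f y z K R).sol 1 := by
  rw [Game.mem_sol_one]
  refine fun i => ⟨mem_insert_self _ _, fun b hb => ?_⟩
  obtain rfl | rfl : b = window y 0 i ∨ b = window z K i := by simpa using hb
  · exact le_rfl
  rw [Game.utility_update_truncate, Game.utility_update_truncate]
  rcases lt_or_ge (i : ℕ) K with hi | hi
  · have hempty : window (R := R) z K i = ∅ :=
      eq_empty_of_forall_notMem fun r hr => by grind [mem_window]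
    rw [hempty, sum_empty]
    positivity
  · simp only [deviationLoss, sum_sub_distrib, sub_nonneg] at hf
    exact (sum_window_deviation_le w f hy i).trans
      (hf.trans_eq (sum_window_outcome w f hy hi).symm)

theorem welfare_window_le (h0 : w 0 = 0) (hw : Monotone w) :
    (windowGame w f y z K R).welfare (window y 0) ≤ R * ∑ t, w (y t) := by
  rw [Game.welfare_eq_sum fun _ => h0]
  calc ∑ r, w ((windowGame w f y z K R).load (window y 0) r)
    _ ≤ ∑ r : Fin (R * T), w (y r.modNat) := by
        refine sum_le_sum fun r _ => hw ?_
        rw [load_window]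
        lia
    _ = R * ∑ t, w (y t) := by
        rw [sum_divNat_modNat fun (_ : Fin R) t => w (y t)]
        simp

theorem le_welfare_window (h0 : w 0 = 0) (hw : Monotone w) {L Q : ℕ} (hz : ∀ t, z t ≤ L)
    (hR : R = Q + K + L) :
    Q * ∑ t, w (z t) ≤ (windowGame w f y z K R).welfare (window z K) := by
  rw [Game.welfare_eq_sum fun _ => h0]
  calc (Q : ℝ) * ∑ t, w (z t)
    _ = ∑ ρ : Fin R, if (ρ : ℕ) < Q then ∑ t, w (z t) else 0 := by
        rw [← sum_filter, sum_const, Fin.card_filter_val_lt, min_eq_right (by lia), nsmul_eq_mul]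
    _ = ∑ r : Fin (R * T), if (r.divNat : ℕ) < Q then w (z r.modNat) else 0 := by
        rw [sum_divNat_modNat fun (ρ : Fin R) t => if (ρ : ℕ) < Q then w (z t) else 0]
        exact sum_congr rfl fun ρ _ => by split_ifs <;> simp
    _ ≤ ∑ r, w ((windowGame w f y z K R).load (window z K) r) := by
        refine sum_le_sum fun r _ => ?_
        rw [load_window]
        split_ifs with hr
        · refine hw ?_
          have := hz r.modNat
          lia
        · exact h0 ▸ hw (Nat.zero_le _)

theorem exists_game_efficiency_le (h0 : w 0 = 0) (hw : Monotone w) {y z : Fin T → ℕ} {β : ℝ}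
    (hβ : 0 < β) (hf : 0 ≤ ∑ t, deviationLoss f (y t) (z t))
    (hlt : β * ∑ t, w (y t) < ∑ t, w (z t)) :
    ∃ G : Game, (∀ r, G.w r = w ∧ G.f r = f) ∧ (∃ a ∈ G.jointActions, 0 < G.welfare a) ∧
      G.efficiency 1 ≤ 1 / β := by
  set A := ∑ t, w (y t)
  set B := ∑ t, w (z t)
  set K := univ.sup y
  set L := univ.sup z
  have hβA : 0 ≤ β * A :=
    mul_nonneg hβ.le (sum_nonneg fun t _ => h0 ▸ hw (Nat.zero_le _))
  obtain ⟨Q, hQ⟩ := exists_nat_gt ((K + L : ℕ) * (β * A) / (B - β * A))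
  rw [div_lt_iff₀ (sub_pos.2 hlt)] at hQ
  have hratio : β * ((Q + K + L : ℕ) * A) < Q * B := by
    push_cast at hQ ⊢
    linarith
  have htarget := le_welfare_window w f (y := y) (K := K) h0 hw
    (fun t => le_sup (mem_univ t)) (rfl : Q + K + L = _)
  have hmem : window z K ∈ (windowGame w f y z K (Q + K + L)).jointActions :=
    fun _ => mem_insert_of_mem (mem_singleton_self _)
  have hnonneg : 0 ≤ β * ((Q + K + L : ℕ) * A) := by
    rw [mul_left_comm]
    exact mul_nonneg (Nat.cast_nonneg _) hβA
  have hpos := hnonneg.trans_lt (hratio.trans_le htarget)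
  refine ⟨windowGame w f y z K (Q + K + L), fun _ => ⟨rfl, rfl⟩, ⟨_, hmem, hpos⟩,
    Game.efficiency_le_one_div hβ (window_mem_sol w f (fun t => le_sup (mem_univ t)) hf) hmem
      hpos ?_⟩
  exact (mul_le_mul_of_nonneg_left (welfare_window_le w f h0 hw) hβ.le).trans
    (hratio.le.trans htarget)

end WindowGame

/-! ### Guarantees of utility designs -/

theorem exists_game_efficiency_le_of_forall_not_lpFeasible {w : WelfareRule} {f : UtilityRule}
    {β : ℝ} (h0 : w 0 = 0) (h1 : w 1 = 1) (hw : Monotone w) (hβ : 0 < β)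
    (h : ∀ F, ¬LPFeasible w F β) :
    ∃ G : Game, (∀ r, G.w r = w ∧ G.f r = f) ∧ (∃ a ∈ G.jointActions, 0 < G.welfare a) ∧
      G.efficiency 1 ≤ 1 / β := by
  by_contra! hG
  obtain ⟨F, hF⟩ := exists_lpFeasible_of_forall_sum_le (f := f) h0 h1 hβ.le fun T y z hloss => by
    by_contra! hlt
    obtain ⟨G, hr, hpos, heff⟩ := exists_game_efficiency_le w f h0 hw hβ hloss hlt
    exact (hG G hr hpos).not_ge heff
  exact h F hF

section Design

variable {𝒲 : Set WelfareRule} {𝒰 : UtilityDesign 𝒲} {v : WelfareRule} {β : ℝ}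

theorem mem_gameClass {G : Game} (hv : v ∈ 𝒲) (hG : ∀ r, G.w r = v ∧ G.f r = 𝒰 ⟨v, hv⟩)
    (hpos : ∃ a ∈ G.jointActions, 0 < G.welfare a) : G ∈ gameClass 𝒲 𝒰 := by
  refine ⟨fun r => ?_, hpos⟩
  obtain ⟨rfl, hf⟩ := hG r
  exact ⟨hv, hf⟩

theorem gameClass_nonempty (hv : v ∈ 𝒲) (h0 : v 0 = 0) (h1 : v 1 = 1) (hmono : Monotone v) :
    (gameClass 𝒲 𝒰).Nonempty := by
  obtain ⟨G, hG, hpos, -⟩ := exists_game_efficiency_le_of_forall_not_lpFeasible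
    (f := 𝒰 ⟨v, hv⟩) h0 h1 hmono one_half_pos
    fun F hF => one_half_lt_one.not_ge (hF.one_le h0 h1)
  exact ⟨G, mem_gameClass hv hG hpos⟩

theorem bddBelow_efficiency (hn : ∀ v ∈ 𝒲, ∀ j, 0 ≤ v j) (𝒰 : UtilityDesign 𝒲) (k : ℕ) :
    BddBelow ((fun G : Game => G.efficiency k) '' gameClass 𝒲 𝒰) :=
  ⟨0, Set.forall_mem_image.2 fun _ hG => Game.efficiency_nonneg (fun r => hn _ (hG.1 r).1) k⟩

theorem classEfficiency_le_one_div (hn : ∀ v ∈ 𝒲, ∀ j, 0 ≤ v j) (hv : v ∈ 𝒲) (h0 : v 0 = 0)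
    (h1 : v 1 = 1) (hmono : Monotone v) (hβ : 0 < β) (hmin : ∀ F b, LPFeasible v F b → β ≤ b) :
    classEfficiency 𝒲 𝒰 1 ≤ 1 / β := by
  have hlower : ∀ b, 0 < b → b < β → classEfficiency 𝒲 𝒰 1 ≤ 1 / b := fun b hb hbβ => by
    obtain ⟨G, hG, hpos, heff⟩ := exists_game_efficiency_le_of_forall_not_lpFeasible
      (f := 𝒰 ⟨v, hv⟩) h0 h1 hmono hb fun F hF => hbβ.not_ge (hmin F b hF)
    exact (csInf_le (bddBelow_efficiency hn 𝒰 1)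
      (Set.mem_image_of_mem _ (mem_gameClass hv hG hpos))).trans heff
  have hlim : Filter.Tendsto (fun b : ℝ => 1 / b) (nhdsWithin β (Set.Iio β)) (nhds (1 / β)) :=
    (continuousAt_const.div continuousAt_id hβ.ne').mono_left nhdsWithin_le_nhds
  refine ge_of_tendsto hlim ?_
  filter_upwards [Ioo_mem_nhdsLT hβ] with b hb using hlower b hb.1 hb.2

theorem one_div_le_classEfficiency (hβ : 0 < β) (h : ∀ v : 𝒲, IsSmooth v (𝒰 v) β)
    (hne : (gameClass 𝒲 𝒰).Nonempty) : 1 / β ≤ classEfficiency 𝒲 𝒰 1 := by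
  refine le_csInf (hne.image _) (Set.forall_mem_image.2 fun G hG => ?_)
  refine Game.one_div_le_efficiency hβ (fun s hs o ho => ?_) hG.2
  refine Game.welfare_le_mul_welfare (fun r => ?_) hs ho
  obtain ⟨hr, hf⟩ := hG.1 r
  exact hf ▸ h ⟨G.w r, hr⟩

theorem optEfficiency_eq_of_forall_le {k : ℕ} {e : ℝ}
    (hle : ∀ 𝒰 : UtilityDesign 𝒲, classEfficiency 𝒲 𝒰 k ≤ e)
    (h𝒰 : classEfficiency 𝒲 𝒰 k = e) : optEfficiency 𝒲 k = e :=
  IsGreatest.csSup_eq ⟨⟨𝒰, h𝒰⟩, Set.forall_mem_range.2 hle⟩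

end Design

section LinearDesign

variable {m : ℕ} {w : Fin m → WelfareRule} {u : Fin m → UtilityRule}

theorem mem_spanned (w : Fin m → WelfareRule) (l : Fin m) : w l ∈ spanned w :=
  ⟨Pi.single l 1, by simp [Pi.single_apply, apply_ite, ite_smul]⟩

theorem nonneg_of_mem_spanned (hw : ∀ l j, 0 ≤ w l j) {v : WelfareRule} (hv : v ∈ spanned w)
    (j : ℕ) : 0 ≤ v j := by
  obtain ⟨α, rfl⟩ := hv
  rw [Finset.sum_apply]
  exact sum_nonneg fun l _ => mul_nonneg (α l).2 (hw l j)

theorem exists_isLinearDesign (w : Fin m → WelfareRule) (u : Fin m → UtilityRule) :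
    ∃ 𝒰 : UtilityDesign (spanned w), IsLinearDesign w u 𝒰 := by
  choose α hα using fun v : spanned w => v.2
  exact ⟨fun v => ∑ l, α v l • u l, fun v => ⟨α v, hα v, rfl⟩⟩

theorem IsLinearDesign.isSmooth {𝒰 : UtilityDesign (spanned w)} (h𝒰 : IsLinearDesign w u 𝒰)
    {β : ℝ} (h : ∀ l, IsSmooth (w l) (u l) β) (v : spanned w) : IsSmooth v (𝒰 v) β := by
  obtain ⟨α, hv, hu⟩ := h𝒰 v
  rw [hv, hu]
  exact IsSmooth.sum_smul (fun l _ => h l) α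

end LinearDesign

end ResourceGame

open ResourceGame in
theorem theorem1 (m : ℕ) (hm : 1 ≤ m) (w : Fin m → WelfareRule)
    (hw0 : ∀ l, w l 0 = 0) (hw1 : ∀ l, w l 1 = 1) (hsub : ∀ l, IsSubmodular (w l)) :
    ∃ β : Fin m → ℝ,
      -- the programs have optimal solutions, even nonincreasing ones, with optimal values `β l > 0`
      (∀ l, 0 < β l ∧ ∃ u : UtilityRule, IsLPSolution (w l) u (β l) ∧ AntitoneOn u (Set.Ici 1)) ∧
      -- the optimal one-round guarantee is the minimum of the numbers `1 / β l`
      IsLeast (Set.range fun l => 1 / β l) (optEfficiency (spanned w) 1) ∧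
      -- linear designs built from nonincreasing optimal solutions exist, and all are optimal
      ∀ u : Fin m → UtilityRule,
        (∀ l, IsLPSolution (w l) (u l) (β l) ∧ AntitoneOn (u l) (Set.Ici 1)) →
        (∃ 𝒰 : UtilityDesign (spanned w), IsLinearDesign w u 𝒰) ∧
        ∀ 𝒰 : UtilityDesign (spanned w), IsLinearDesign w u 𝒰 →
          classEfficiency (spanned w) 𝒰 1 = optEfficiency (spanned w) 1 := by
  choose β u hu using fun l => exists_isLPSolution_antitoneOn (hsub l) (hw0 l) (hw1 l)
  have hβ : ∀ l, 0 < β l := fun l => one_pos.trans_le ((hu l).1.1.one_le (hw0 l) (hw1 l))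
  have hn : ∀ l j, 0 ≤ w l j := fun l => (hsub l).nonneg (hw0 l)
  have : NeZero m := ⟨Nat.one_le_iff_ne_zero.1 hm⟩
  obtain ⟨k, hk⟩ := Finite.exists_max β
  have hle : ∀ 𝒰 : UtilityDesign (spanned w), classEfficiency (spanned w) 𝒰 1 ≤ 1 / β k :=
    fun 𝒰 => classEfficiency_le_one_div (fun _ => nonneg_of_mem_spanned hn) (mem_spanned w k)
      (hw0 k) (hw1 k) (hsub k).monotone (hβ k) (hu k).1.2
  have hlinear : ∀ u' : Fin m → UtilityRule,
      (∀ l, IsLPSolution (w l) (u' l) (β l) ∧ AntitoneOn (u' l) (Set.Ici 1)) →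
      ∀ 𝒰, IsLinearDesign w u' 𝒰 → classEfficiency (spanned w) 𝒰 1 = 1 / β k := by
    refine fun u' hu' 𝒰 h𝒰 => le_antisymm (hle 𝒰) (one_div_le_classEfficiency (hβ k)
      (h𝒰.isSmooth fun l => ?_)
      (gameClass_nonempty (mem_spanned w k) (hw0 k) (hw1 k) (hsub k).monotone))
    exact ((hu' l).1.1.mono (hn l) (hk l)).isSmooth (hw0 l)
      ((hsub l).le_natCast (hw0 l) (hw1 l)) (hu' l).2
  have hopt : optEfficiency (spanned w) 1 = 1 / β k := by
    obtain ⟨𝒰, h𝒰⟩ := exists_isLinearDesign w u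
    exact optEfficiency_eq_of_forall_le hle (hlinear u hu 𝒰 h𝒰)
  refine ⟨β, fun l => ⟨hβ l, u l, hu l⟩, ⟨⟨k, hopt.symm⟩, ?_⟩, fun u' hu' =>
    ⟨exists_isLinearDesign w u', fun 𝒰 h𝒰 => (hlinear u' hu' 𝒰 h𝒰).trans hopt.symm⟩⟩
  rw [hopt]
  exact Set.forall_mem_range.2 fun l => one_div_le_one_div_of_le (hβ l) (hk l)
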